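/- All graphs are finite, and may have loops and parallel edges. Each edge consists of two distinct half-edges, each incident on one vertex. A graph is 4-regular if every vertex is incident on exactly four half-edges. A circuit is a closed walk of positive length, with no repeated edge (vertices may repeat); it is considered up to choice of starting point and direction. A circuit partition of a graph is a set of circuits such that each edge lies in exactly one of them. An Euler circuit of a connected component is a circuit that contains every edge of the component, and an Euler system is a set of Euler circuits, exactly one for each connected component. Let $F$ be a 4-regular graph with vertex set $V$. A transition at $v\in V$ is a partition of the four half-edges incident on $v$ into two pairs. A circuit partition $P$ involves one transition at each vertex $v$: two half-edges are paired if a circuit of $P$ arrives at $v$ along one of them and then leaves $v$ along the other. Let $C$ be an Euler system of $F$, and orient its circuits arbitrarily. Of the three transitions at $v$, let $\phi$ be the one involved in $C$, let $\chi$ be the other one in which each pair consists of an incoming and an outgoing half-edge, and let $\psi$ be the remaining one. (These do not depend on the orientations.) The interlacement graph $\mathcal I(C)$ is the simple graph on $V$ in which distinct vertices $v,w$ are adjacent if and only if they appear in the cyclic order $v\ldots w\ldots v\ldots w$ on a circuit of $C$. For a circuit partition $P$ of $F$, the modified interlacement matrix $M(C,P)$ is the $V\times V$ matrix over $GF(2)$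 obtained from the adjacency matrix of $\mathcal I(C)$ as follows: for each $v$ at which $P$ involves the $\phi$ transition with respect to $C$, change the diagonal entry of column $v$ to $1$ and all other entries of column $v$ to $0$; for each $v$ at which $P$ involves the $\psi$ transition with respect to $C$, change the diagonal entry of column $v$ to $1$. The core vector $core(\gamma)\in GF(2)^{V}$ of a circuit $\gamma$ has $v$ coordinate $1$ if and only if $\gamma$ includes precisely two of the four half-edges incident on $v$. The core space $core(P)$ is the subspace of $GF(2)^V$ spanned by the core vectors of the circuits of $P$. Theorem. Let $P$ be a circuit partition of a 4-regular graph $F$, and let $C$ be an Euler system of $F$. Then \[ core(P)=\ker M(C,P)=\{n\in GF(2)^{V}\mid M(C,P)\cdot n=\mathbf 0\}. \] -/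

import Mathlib

/-- A graph, possibly with loops and parallel edges, with vertex set `V` and edge set `E`.
The edge `e` consists of two distinct half-edges `(e, false)` and `(e, true)`, and each half-edge
is incident on one vertex. -/
structure HalfEdgeGraph (V E : Type*) where
  /-- The vertex on which a half-edge is incident. -/
  vtx : E × Bool → V

namespace HalfEdgeGraph

variable {V E : Type*}

/-- The other half-edge of the same edge. -/
def flip (h : E × Bool) : E × Bool := (h.1, !h.2)

/-- Every vertex is incident on exactly four half-edges. -/
def IsFourRegular (F : HalfEdgeGraph V E) : Prop :=
  ∀ v : V, {h : E × Bool | F.vtx h = v}.ncard = 4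

/-- The connected components: the classes of the equivalence relation on vertices and edges that is
generated by the incidences. -/
def Component (F : HalfEdgeGraph V E) :=
  Quot (fun x y : V ⊕ E => ∃ h : E × Bool, x = Sum.inl (F.vtx h) ∧ y = Sum.inr h.1)

/-- A circuit with `len + 1` edges, which may repeat vertices but not edges. The half-edge
`dart i` is the one by which the `i`-th edge is entered and `flip (dart i)` is the one by which it
is left. The addition in `Fin (len + 1)` is cyclic, so the last edge leads back to the first. The
chosen starting point and direction are those of a written-down sequence. -/
structure Circuit (F : HalfEdgeGraph V E) where
  len : ℕ
  dart : Fin (len + 1) → E × Bool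
  edge_injective : Function.Injective (fun i => (dart i).1)
  closed : ∀ i, F.vtx (flip (dart i)) = F.vtx (dart (i + 1))

variable {F : HalfEdgeGraph V E}

/-- The edge `e` appears in the circuit. -/
def Circuit.Uses (γ : F.Circuit) (e : E) : Prop := ∃ i, (γ.dart i).1 = e

/-- The half-edge `h` appears in the circuit. -/
def Circuit.Includes (γ : F.Circuit) (h : E × Bool) : Prop :=
  ∃ i, γ.dart i = h ∨ flip (γ.dart i) = h

/-- The edges of the circuit `γ` are exactly the edges of the connected component `K`. -/
def Circuit.IsEulerCircuitOf (γ : F.Circuit) (K : F.Component) : Prop :=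
  ∀ e : E, γ.Uses e ↔ (Quot.mk _ (Sum.inr e) : F.Component) = K

/-- A set of circuits that partitions the edge set. -/
def IsCircuitPartition (P : Set F.Circuit) : Prop :=
  ∀ e : E, ∃! γ : F.Circuit, γ ∈ P ∧ γ.Uses e

/-- A set of Euler circuits of connected components, one for each connected component. -/
def IsEulerSystem (C : Set F.Circuit) : Prop :=
  (∀ γ ∈ C, ∃ K : F.Component, γ.IsEulerCircuitOf K) ∧
    ∀ K : F.Component, ∃! γ : F.Circuit, γ ∈ C ∧ γ.IsEulerCircuitOf K

/-- The sequence of vertices of `γ`, read from its starting point, contains `v ... w ... v ... w`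
in this order. -/
def Circuit.Alternates (γ : F.Circuit) (v w : V) : Prop :=
  ∃ i j k l : Fin (γ.len + 1), i < j ∧ j < k ∧ k < l ∧
    F.vtx (γ.dart i) = v ∧ F.vtx (γ.dart j) = w ∧
    F.vtx (γ.dart k) = v ∧ F.vtx (γ.dart l) = w

/-- The interlacement graph: two distinct vertices are adjacent when they appear in the cyclic order
`v ... w ... v ... w` on a circuit of `C`. Read from the starting point of the circuit, this
is either `v ... w ... v ... w` or `w ... v ... w ... v`. -/
def interlacementGraph (C : Set F.Circuit) : SimpleGraph V where
  Adj v w := v ≠ w ∧ ∃ γ ∈ C, γ.Alternates v w ∨ γ.Alternates w v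
  symm := ⟨fun _ _ h => ⟨h.1.symm, h.2.imp fun _ hγ => ⟨hγ.1, hγ.2.symm⟩⟩⟩
  loopless := ⟨fun _ h => h.1 rfl⟩

/-- The transition at `v` that appears in the set of circuits `P`: the set of the unordered pairs of
half-edges by which a circuit of `P` arrives at `v` and then leaves `v`. For a circuit
partition of a 4-regular graph it is a pairing of the four half-edges at `v`. -/
def transitionAt (P : Set F.Circuit) (v : V) : Set (Sym2 (E × Bool)) :=
  {p | ∃ γ ∈ P, ∃ i, F.vtx (γ.dart (i + 1)) = v ∧ p = s(flip (γ.dart i), γ.dart (i + 1))}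

/-- `h` is the initial half-edge of its edge, in the direction in which `C` traverses that edge. -/
def IsOutgoing (C : Set F.Circuit) (h : E × Bool) : Prop :=
  ∃ γ ∈ C, ∃ i, γ.dart i = h

/-- The transition `T` is consistent with the orientation of the circuits of `C`: each pair of `T`
consists of an incoming and an outgoing half-edge. -/
def IsConsistent (C : Set F.Circuit) (T : Set (Sym2 (E × Bool))) : Prop :=
  ∀ h h' : E × Bool, s(h, h') ∈ T → (IsOutgoing C h ↔ ¬ IsOutgoing C h')

/-- At `v`, `P` involves the transition `φ` with respect to `C`: the one that appears in `C`. -/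
def InvolvesPhi (C P : Set F.Circuit) (v : V) : Prop :=
  transitionAt P v = transitionAt C v

/-- At `v`, `P` involves the transition `χ` with respect to `C`: not the one that appears in `C`,
and consistent with the orientation of the circuits of `C`. -/
def InvolvesChi (C P : Set F.Circuit) (v : V) : Prop :=
  transitionAt P v ≠ transitionAt C v ∧ IsConsistent C (transitionAt P v)

/-- At `v`, `P` involves the transition `ψ` with respect to `C`: not the one that appears in `C`,
and not consistent with the orientation of the circuits of `C`. -/
def InvolvesPsi (C P : Set F.Circuit) (v : V) : Prop :=
  transitionAt P v ≠ transitionAt C v ∧ ¬ IsConsistent C (transitionAt P v)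

open scoped Classical in
/-- The modified interlacement matrix of `C` with respect to `P`, with row index `w` and column
index `v`. -/
noncomputable def modifiedInterlacementMatrix (C P : Set F.Circuit) : Matrix V V (ZMod 2) :=
  Matrix.of fun w v =>
    if InvolvesPhi C P v then (if w = v then 1 else 0)
    else if InvolvesPsi C P v ∧ w = v then 1
    else (interlacementGraph C).adjMatrix (ZMod 2) w v

open scoped Classical in
/-- The core vector of `γ`: its `v` coordinate is 1 when `γ` includes precisely two of the
half-edges incident on `v`. -/
noncomputable def Circuit.coreVector (γ : F.Circuit) : V → ZMod 2 :=
  fun v => if {h : E × Bool | F.vtx h = v ∧ γ.Includes h}.ncard = 2 then 1 else 0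

/-- The core space of `P`: the span of the core vectors of the circuits of `P`. -/
def coreSpace (P : Set F.Circuit) : Submodule (ZMod 2) (V → ZMod 2) :=
  Submodule.span (ZMod 2) (Circuit.coreVector '' P)

end HalfEdgeGraph

namespace HalfEdgeGraph

variable {V E : Type*} {F : HalfEdgeGraph V E}

/-! Weightings `x : E → ZMod 2` constant on each circuit of `P` are the combinations of indicator
functions of those circuits. At a vertex, `P` groups the four half-edges into two pairs, and a
circuit contains both or neither half-edge of a pair. Hence `core(P)` consists of the vectors `n`
for which `n v` is the difference of the values of such an `x` on the two pairs at `v`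
(`IsPartner.mem_coreSpace_iff`).

Read these conditions along the Euler system. Let the two passages of `v` arrive by `a`, `c` and
leave by `b`, `d` respectively. The pairs of `P` are `{a,b}, {c,d}` for `φ`, `{a,d}, {c,b}` for `χ`
and `{a,c}, {b,d}` for `ψ`. In every case the conditions at `v` say that `x` jumps by the same
amount at both passages (`0` for `φ`, otherwise `n v`), and that `x b + x d` is `n v`, `n v` or `0`
respectively (`core_condition_iff`).

The jumps determine `x` on each Euler circuit, up to a constant, as a prefix sum. This closes up
cyclically because each vertex is passed twice. The sum of the two prefix sums at `v` is the jump at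
`v` plus the jumps at the vertices interlaced with `v`, since exactly these are met once between the
two passages (`IsEulerSystem.sum_Iic_add_sum_Iic`). The remaining condition on `x b + x d` is then
row `v` of `M(C,P) n = 0`. -/

@[simp] theorem flip_fst (h : E × Bool) : (flip h).1 = h.1 := rfl

@[simp] theorem flip_flip (h : E × Bool) : flip (flip h) = h := by
  simp [flip]

theorem flip_ne (h : E × Bool) : flip h ≠ h := by
  intro H
  have := congrArg Prod.snd H
  simp [flip] at this

theorem eq_or_eq_flip {h h' : E × Bool} (H : h.1 = h'.1) : h = h' ∨ h = flip h' := by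
  obtain ⟨e, b⟩ := h
  obtain ⟨e', b'⟩ := h'
  obtain rfl : e = e' := H
  cases b <;> cases b' <;> simp [flip]

theorem Circuit.includes_iff_uses (γ : F.Circuit) (h : E × Bool) :
    γ.Includes h ↔ γ.Uses h.1 := by
  constructor
  · rintro ⟨i, rfl | rfl⟩ <;> exact ⟨i, rfl⟩
  · rintro ⟨i, hi⟩
    refine ⟨i, ?_⟩
    rcases eq_or_eq_flip hi with H | H
    · exact .inl H
    · exact .inr (by rw [H, flip_flip])

/-! ### Circuit partitions as fixed-point-free involutions of the half-edges. -/

/-- In a circuit partition an edge determines the circuit and the position at which it occurs. -/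
theorem IsCircuitPartition.position_unique {P : Set F.Circuit} (hP : IsCircuitPartition P)
    {γ γ' : F.Circuit} (hγ : γ ∈ P) (hγ' : γ' ∈ P) {i : Fin (γ.len + 1)} {j : Fin (γ'.len + 1)}
    (h : (γ.dart i).1 = (γ'.dart j).1) : (⟨γ, i⟩ : Σ γ : F.Circuit, Fin (γ.len + 1)) = ⟨γ', j⟩ := by
  obtain rfl : γ = γ' := (hP (γ.dart i).1).unique ⟨hγ, i, rfl⟩ ⟨hγ', j, h.symm⟩
  rw [γ.edge_injective h]

theorem IsCircuitPartition.exists_position {P : Set F.Circuit} (hP : IsCircuitPartition P)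
    (e : E) : ∃ γ ∈ P, ∃ i, (γ.dart i).1 = e := by
  obtain ⟨γ, ⟨hγ, hi⟩, -⟩ := hP e
  exact ⟨γ, hγ, hi⟩

/-- `τ` maps each half-edge to the one with which the circuits of `P` pair it. -/
structure IsPartner (P : Set F.Circuit) (τ : E × Bool → E × Bool) : Prop where
  invol : ∀ h, τ (τ h) = h
  ne : ∀ h, τ h ≠ h
  vtx : ∀ h, F.vtx (τ h) = F.vtx h
  flip_dart : ∀ γ ∈ P, ∀ i, τ (flip (γ.dart i)) = γ.dart (i + 1)

/-- Each edge has a single position in `P`, so each half-edge is an arrival or a departure exactly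
once, and its mate in that passage is a function of it. -/
theorem IsCircuitPartition.exists_partner {P : Set F.Circuit} (hP : IsCircuitPartition P) :
    ∃ τ, IsPartner P τ := by
  have key : ∀ h : E × Bool, ∃ h', (∃ γ ∈ P, ∃ i,
      (h = flip (γ.dart i) ∧ h' = γ.dart (i + 1)) ∨
        (h' = flip (γ.dart i) ∧ h = γ.dart (i + 1))) := by
    intro h
    obtain ⟨γ, hγ, i, hi⟩ := hP.exists_position h.1
    rcases eq_or_eq_flip hi.symm with H | H
    · exact ⟨flip (γ.dart (i - 1)), γ, hγ, i - 1, .inr ⟨rfl, by simpa using H⟩⟩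
    · exact ⟨_, γ, hγ, i, .inl ⟨H, rfl⟩⟩
  have uniq : ∀ h h₁ h₂ : E × Bool, (∃ γ ∈ P, ∃ i,
      (h = flip (γ.dart i) ∧ h₁ = γ.dart (i + 1)) ∨
        (h₁ = flip (γ.dart i) ∧ h = γ.dart (i + 1))) → (∃ γ ∈ P, ∃ i,
      (h = flip (γ.dart i) ∧ h₂ = γ.dart (i + 1)) ∨
        (h₂ = flip (γ.dart i) ∧ h = γ.dart (i + 1))) → h₁ = h₂ := by
    rintro h h₁ h₂ ⟨γ, hγ, i, H⟩ ⟨γ', hγ', j, H'⟩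
    rcases H with ⟨rfl, rfl⟩ | ⟨rfl, rfl⟩ <;> rcases H' with ⟨H, rfl⟩ | ⟨rfl, H⟩ <;>
      have E0 := congrArg Prod.fst H <;> (try simp only [flip_fst] at E0) <;>
      have E1 := hP.position_unique hγ hγ' E0 <;>
      rw [Sigma.mk.injEq] at E1 <;> obtain ⟨rfl, E1⟩ := E1 <;> have E1 := eq_of_heq E1
    · rw [E1]
    · exact absurd (E1 ▸ H) (flip_ne _)
    · exact absurd (E1 ▸ H).symm (flip_ne _)
    · rw [add_right_cancel E1]
  choose τ hτ using key
  refine ⟨τ, fun h => ?_, fun h H => ?_, fun h => ?_, fun γ hγ i => ?_⟩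
  · refine uniq (τ h) _ _ (hτ (τ h)) ?_
    obtain ⟨γ, hγ, i, H⟩ := hτ h
    exact ⟨γ, hγ, i, H.symm⟩
  · obtain ⟨γ, hγ, i, H'⟩ := hτ h
    -- A self-paired half-edge forces consecutive positions to carry the same edge. The circuit then
    -- has length one, and a half-edge would equal its own flip.
    have H2 : flip (γ.dart i) = γ.dart (i + 1) := by
      rcases H' with ⟨h1, h2⟩ | ⟨h1, h2⟩ <;> rw [← h1, ← h2, H]
    have H3 := γ.edge_injective (by simpa using congrArg Prod.fst H2)
    rw [← H3] at H2
    exact flip_ne _ H2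
  · obtain ⟨γ, hγ, i, ⟨h1, h2⟩ | ⟨h1, h2⟩⟩ := hτ h
    · rw [h2, h1, γ.closed]
    · rw [h1, h2, γ.closed]
  · exact uniq _ _ _ (hτ _) ⟨γ, hγ, i, .inl ⟨rfl, rfl⟩⟩

/-- Turns comparisons of transitions into comparisons of involutions. -/
theorem IsPartner.mem_transitionAt {P : Set F.Circuit} (hP : IsCircuitPartition P)
    {τ : E × Bool → E × Bool} (hτ : IsPartner P τ) (v : V) (h h' : E × Bool) :
    s(h, h') ∈ transitionAt P v ↔ F.vtx h = v ∧ h' = τ h := by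
  constructor
  · rintro ⟨γ, hγ, i, hv, hp⟩
    have H := hτ.flip_dart γ hγ i
    rcases Sym2.eq_iff.1 hp with ⟨rfl, rfl⟩ | ⟨rfl, rfl⟩
    · exact ⟨(γ.closed i).trans hv, H.symm⟩
    · exact ⟨hv, by rw [← H, hτ.invol]⟩
  · rintro ⟨rfl, rfl⟩
    obtain ⟨γ, hγ, i, hi⟩ := hP.exists_position h.1
    rcases eq_or_eq_flip hi.symm with rfl | rfl
    · have H := hτ.flip_dart γ hγ (i - 1)
      rw [sub_add_cancel] at H
      refine ⟨γ, hγ, i - 1, by simp, ?_⟩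
      rw [sub_add_cancel, ← H, hτ.invol, Sym2.eq_swap]
    · exact ⟨γ, hγ, i, (γ.closed i).symm, by rw [hτ.flip_dart γ hγ]⟩

/-! ### Euler systems and their passages through a vertex. -/

theorem IsEulerSystem.isCircuitPartition {C : Set F.Circuit} (hC : IsEulerSystem C) :
    IsCircuitPartition C := by
  intro e
  obtain ⟨γ, ⟨hγ, hK⟩, hu⟩ := hC.2 (Quot.mk _ (Sum.inr e))
  refine ⟨γ, ⟨hγ, (hK e).2 rfl⟩, ?_⟩
  rintro γ' ⟨hγ', he⟩
  obtain ⟨K, hK'⟩ := hC.1 γ' hγ'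
  refine hu γ' ⟨hγ', ?_⟩
  rwa [(hK' e).1 he]

/-- The circuits of an Euler system that pass a vertex coincide. -/
theorem IsEulerSystem.circuit_unique {C : Set F.Circuit} (hC : IsEulerSystem C)
    {γ γ' : F.Circuit} (hγ : γ ∈ C) (hγ' : γ' ∈ C) {i : Fin (γ.len + 1)} {j : Fin (γ'.len + 1)}
    (h : F.vtx (γ.dart i) = F.vtx (γ'.dart j)) : γ = γ' := by
  obtain ⟨K, hK⟩ := hC.1 γ hγ
  obtain ⟨K', hK'⟩ := hC.1 γ' hγ'
  have h1 := (hK (γ.dart i).1).1 ⟨i, rfl⟩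
  have h2 := (hK' (γ'.dart j).1).1 ⟨j, rfl⟩
  have h3 : (Quot.mk _ (Sum.inl (F.vtx (γ.dart i))) : F.Component) =
      Quot.mk _ (Sum.inr (γ.dart i).1) := Quot.sound ⟨_, rfl, rfl⟩
  have h4 : (Quot.mk _ (Sum.inl (F.vtx (γ'.dart j))) : F.Component) =
      Quot.mk _ (Sum.inr (γ'.dart j).1) := Quot.sound ⟨_, rfl, rfl⟩
  have hKK : K = K' := by rw [← h1, ← h2, ← h3, ← h4, h]
  subst hKK
  exact (hC.2 K).unique ⟨hγ, hK⟩ ⟨hγ', hK'⟩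

theorem isOutgoing_dart {C : Set F.Circuit} {γ : F.Circuit} (hγ : γ ∈ C)
    (i : Fin (γ.len + 1)) : IsOutgoing C (γ.dart i) := ⟨γ, hγ, i, rfl⟩

theorem IsCircuitPartition.not_isOutgoing_flip_dart {C : Set F.Circuit}
    (hC : IsCircuitPartition C) {γ : F.Circuit} (hγ : γ ∈ C)
    (i : Fin (γ.len + 1)) : ¬ IsOutgoing C (flip (γ.dart i)) := by
  rintro ⟨γ', hγ', j, hj⟩
  have E1 := hC.position_unique hγ' hγ (by simpa using congrArg Prod.fst hj)
  rw [Sigma.mk.injEq] at E1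
  obtain ⟨rfl, E1⟩ := E1
  rw [eq_of_heq E1] at hj
  exact flip_ne _ hj.symm

/-- An Euler system passes each vertex exactly twice, on one circuit, and the four half-edges at the
vertex are those by which these passages arrive and leave. -/
theorem IsEulerSystem.exists_passages [Finite E] (hF : F.IsFourRegular) {C : Set F.Circuit}
    (hC : IsEulerSystem C) (v : V) :
    ∃ γ ∈ C, ∃ i j : Fin (γ.len + 1), i ≠ j ∧
      (∀ h, F.vtx h = v ↔ h = flip (γ.dart i) ∨ h = γ.dart (i + 1) ∨
        h = flip (γ.dart j) ∨ h = γ.dart (j + 1)) := by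
  have hP := hC.isCircuitPartition
  obtain ⟨τ, hτ⟩ := hP.exists_partner
  have pass : ∀ h, F.vtx h = v → ∃ γ ∈ C, ∃ i : Fin (γ.len + 1), F.vtx (γ.dart (i + 1)) = v ∧
      (h = flip (γ.dart i) ∨ h = γ.dart (i + 1)) := by
    rintro h rfl
    obtain ⟨γ, hγ, i, hv, hp⟩ := (hτ.mem_transitionAt hP (F.vtx h) h (τ h)).2 ⟨rfl, rfl⟩
    refine ⟨γ, hγ, i, hv, ?_⟩
    rcases Sym2.eq_iff.1 hp with ⟨H, -⟩ | ⟨H, -⟩ <;> simp [H]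
  have h4 := hF v
  obtain ⟨h, hh⟩ : {h : E × Bool | F.vtx h = v}.Nonempty := by
    rw [← Set.ncard_pos]; omega
  obtain ⟨γ, hγ, i, hi, -⟩ := pass h hh
  -- One passage covers only two of the four half-edges, so there is a second one; it lies on the
  -- same circuit because each component has a single Euler circuit.
  obtain ⟨h', hh', hne⟩ : ∃ h', F.vtx h' = v ∧
      h' ∉ ({flip (γ.dart i), γ.dart (i + 1)} : Set (E × Bool)) := by
    by_contra! H
    have := Set.ncard_le_ncard (show {h : E × Bool | F.vtx h = v} ⊆ _ from H)
    have := Set.ncard_insert_le (flip (γ.dart i)) {γ.dart (i + 1)}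
    have := Set.ncard_singleton (γ.dart (i + 1))
    omega
  obtain ⟨γ', hγ', j, hj, hh⟩ := pass h' hh'
  obtain rfl := hC.circuit_unique hγ hγ' (hi.trans hj.symm)
  have hij : i ≠ j := by
    rintro rfl
    exact hne hh
  refine ⟨γ, hγ, i, j, hij, ?_⟩
  have hdart : ∀ {k l}, γ.dart k = γ.dart l → k = l := fun H =>
    γ.edge_injective (congrArg Prod.fst H)
  have hne' : ∀ k l, flip (γ.dart k) ≠ γ.dart l := fun k l H =>
    hP.not_isOutgoing_flip_dart hγ k (H ▸ isOutgoing_dart hγ l)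
  have hflip : ∀ {k l}, flip (γ.dart k) = flip (γ.dart l) → k = l := fun H =>
    γ.edge_injective (by simpa using congrArg Prod.fst H)
  have hS : ({flip (γ.dart i), γ.dart (i + 1), flip (γ.dart j), γ.dart (j + 1)} :
      Set (E × Bool)).ncard = 4 := by
    rw [Set.ncard_eq_succ (n := 3) |>.2]
    refine ⟨_, {γ.dart (i + 1), flip (γ.dart j), γ.dart (j + 1)}, ?_, rfl, ?_⟩
    · simp only [Set.mem_insert_iff, Set.mem_singleton_iff, not_or]
      exact ⟨hne' _ _, fun H => hij (hflip H), hne' _ _⟩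
    · rw [Set.ncard_eq_three]
      exact ⟨_, _, _, (hne' _ _).symm, fun H => hij (add_right_cancel (hdart H)), hne' _ _, rfl⟩
  have hsub : ({flip (γ.dart i), γ.dart (i + 1), flip (γ.dart j), γ.dart (j + 1)} :
      Set (E × Bool)) ⊆ {h | F.vtx h = v} := by
    rintro h (rfl | rfl | rfl | rfl)
    · exact (γ.closed i).trans hi
    · exact hi
    · exact (γ.closed j).trans hj
    · exact hj
  have heq := Set.eq_of_subset_of_ncard_le hsub (by rw [hS, h4])
  intro h
  exact (Set.ext_iff.1 heq h).symm

/-! ### The core space in terms of edge weightings. -/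

theorem IsPartner.vertex_eq [Finite E] (hF : F.IsFourRegular) {P : Set F.Circuit}
    {τ : E × Bool → E × Bool} (hτ : IsPartner P τ) {h h' : E × Bool}
    (hv : F.vtx h' = F.vtx h) (h1 : h' ≠ h) (h2 : h' ≠ τ h) (k : E × Bool) :
    F.vtx k = F.vtx h ↔ k = h ∨ k = τ h ∨ k = h' ∨ k = τ h' := by
  have e1 := hτ.ne h
  have e2 := hτ.ne h'
  have e3 : τ h' ≠ h := fun H => h2 (by rw [← H, hτ.invol])
  have e4 : τ h' ≠ τ h := fun H => h1 (by rw [← hτ.invol h', H, hτ.invol])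
  have hS : ({h, τ h, h', τ h'} : Set (E × Bool)).ncard = 4 := by
    rw [Set.ncard_eq_succ (n := 3) |>.2]
    refine ⟨_, {τ h, h', τ h'}, ?_, rfl, ?_⟩
    · simp only [Set.mem_insert_iff, Set.mem_singleton_iff, not_or]
      exact ⟨e1.symm, h1.symm, e3.symm⟩
    · rw [Set.ncard_eq_three]
      exact ⟨_, _, _, h2.symm, e4.symm, e2.symm, rfl⟩
  have hsub : ({h, τ h, h', τ h'} : Set (E × Bool)) ⊆ {k | F.vtx k = F.vtx h} := by
    rintro k (rfl | rfl | rfl | rfl)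
    · rfl
    · exact hτ.vtx _
    · exact hv
    · exact (hτ.vtx _).trans hv
  have heq := Set.eq_of_subset_of_ncard_le hsub (by rw [hS, hF])
  exact (Set.ext_iff.1 heq k).symm

theorem IsFourRegular.exists_other [Finite E] (hF : F.IsFourRegular)
    (τ : E × Bool → E × Bool) (v : V) :
    ∃ h h', F.vtx h = v ∧ F.vtx h' = v ∧ h' ≠ h ∧ h' ≠ τ h := by
  have h4 := hF v
  obtain ⟨h, hh⟩ : {h : E × Bool | F.vtx h = v}.Nonempty := by
    rw [← Set.ncard_pos]; omega
  obtain ⟨h', hh', hne⟩ : ∃ h', F.vtx h' = v ∧ h' ∉ ({h, τ h} : Set (E × Bool)) := by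
    by_contra! H
    have := Set.ncard_le_ncard (show {h : E × Bool | F.vtx h = v} ⊆ _ from H)
    have := Set.ncard_insert_le h {τ h}
    have := Set.ncard_singleton (τ h)
    omega
  simp only [Set.mem_insert_iff, Set.mem_singleton_iff, not_or] at hne
  exact ⟨h, h', hh, hh', hne.1, hne.2⟩

theorem IsPartner.uses_iff {P : Set F.Circuit}
    {τ : E × Bool → E × Bool} (hτ : IsPartner P τ) {γ : F.Circuit} (hγ : γ ∈ P) (h : E × Bool) :
    γ.Uses (τ h).1 ↔ γ.Uses h.1 := by
  have key : ∀ h, γ.Uses h.1 → γ.Uses (τ h).1 := by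
    rintro h ⟨i, hi⟩
    rcases eq_or_eq_flip hi.symm with rfl | rfl
    · have H := hτ.flip_dart γ hγ (i - 1)
      rw [sub_add_cancel] at H
      rw [← H, hτ.invol]
      exact ⟨i - 1, rfl⟩
    · rw [hτ.flip_dart γ hγ]
      exact ⟨i + 1, rfl⟩
  exact ⟨fun H => hτ.invol h ▸ key _ H, key h⟩

-- A circuit takes whole pairs, so it includes 0, 2 or 4 half-edges at the vertex, and 2 exactly
-- when it takes one of the pairs. Taking both gives `1 + 1 = 0`.
open scoped Classical in
theorem IsPartner.coreVector_apply [Finite E] (hF : F.IsFourRegular) {P : Set F.Circuit}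
    {τ : E × Bool → E × Bool} (hτ : IsPartner P τ) {γ : F.Circuit} (hγ : γ ∈ P) {h h' : E × Bool}
    (hv : F.vtx h' = F.vtx h) (h1 : h' ≠ h) (h2 : h' ≠ τ h) :
    γ.coreVector (F.vtx h) = (if γ.Uses h.1 then 1 else 0) + (if γ.Uses h'.1 then 1 else 0) := by
  have hset : {k : E × Bool | F.vtx k = F.vtx h ∧ γ.Includes k} =
      {k | (k = h ∨ k = τ h) ∧ γ.Uses h.1} ∪ {k | (k = h' ∨ k = τ h') ∧ γ.Uses h'.1} := by
    ext k
    simp only [Set.mem_ofPred_eq, Set.mem_union, hτ.vertex_eq hF hv h1 h2,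
      Circuit.includes_iff_uses]
    have e1 := hτ.uses_iff hγ h
    have e2 := hτ.uses_iff hγ h'
    grind
  have pair : ∀ k, ({l | l = k ∨ l = τ k} : Set (E × Bool)).ncard = 2 := fun k =>
    Set.ncard_pair (hτ.ne k).symm
  unfold Circuit.coreVector
  rw [hset]
  by_cases u : γ.Uses h.1 <;> by_cases u' : γ.Uses h'.1
  · have : ({k | (k = h ∨ k = τ h) ∧ γ.Uses h.1} ∪ {k | (k = h' ∨ k = τ h') ∧ γ.Uses h'.1} :
        Set (E × Bool)) = {k | F.vtx k = F.vtx h} := by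
      ext k
      simp only [Set.mem_ofPred_eq, Set.mem_union, hτ.vertex_eq hF hv h1 h2, u, u', and_true]
      tauto
    rw [this, hF]
    simp only [u, u', if_true]
    decide
  · simp [u, u', pair]
  · simp [u, u', pair]
  · simp [u, u']

/-- The core space consists of the vectors that compare the values, on the two pairs of half-edges
at each vertex, of an edge weighting that is constant on circuits. -/
theorem IsPartner.mem_coreSpace_iff [Finite E] (hF : F.IsFourRegular) {P : Set F.Circuit}
    (hP : IsCircuitPartition P) {τ : E × Bool → E × Bool} (hτ : IsPartner P τ)
    (n : V → ZMod 2) :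
    n ∈ coreSpace P ↔ ∃ x : E → ZMod 2, ∀ v, (∀ h, F.vtx h = v → x (τ h).1 = x h.1) ∧
      ∀ h h', F.vtx h = v → F.vtx h' = v → h' ≠ h → h' ≠ τ h → n v = x h.1 + x h'.1 := by
  classical
  constructor
  · intro hn
    induction hn using Submodule.span_induction with
    | mem n hn =>
      obtain ⟨γ, hγ, rfl⟩ := hn
      refine ⟨fun e => if γ.Uses e then 1 else 0, fun v => ⟨fun h _ => ?_, ?_⟩⟩
      · simp only [hτ.uses_iff hγ]
      · rintro h h' rfl hv h1 h2
        exact hτ.coreVector_apply hF hγ hv h1 h2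
    | zero => exact ⟨0, by simp⟩
    | add n m _ _ hn hm =>
      obtain ⟨x, hx⟩ := hn
      obtain ⟨y, hy⟩ := hm
      refine ⟨x + y, fun v => ⟨fun h hv => ?_, fun h h' hv hv' h1 h2 => ?_⟩⟩
      · simp only [Pi.add_apply, (hx v).1 h hv, (hy v).1 h hv]
      · simp only [Pi.add_apply, (hx v).2 h h' hv hv' h1 h2, (hy v).2 h h' hv hv' h1 h2]
        ring
    | smul c n _ hn =>
      obtain ⟨x, hx⟩ := hn
      refine ⟨c • x, fun v => ⟨fun h hv => ?_, fun h h' hv hv' h1 h2 => ?_⟩⟩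
      · simp only [Pi.smul_apply, (hx v).1 h hv]
      · simp only [Pi.smul_apply, (hx v).2 h h' hv hv' h1 h2, smul_add]
  · rintro ⟨x, hx⟩
    have hconst : ∀ γ ∈ P, ∀ i, x (γ.dart i).1 = x (γ.dart 0).1 := by
      intro γ hγ i
      induction i using Fin.induction with
      | zero => rfl
      | succ i ih =>
        rw [← ih, ← Fin.coeSucc_eq_succ, ← hτ.flip_dart γ hγ, (hx _).1 _ rfl, flip_fst]
    -- A circuit of `P` is determined by its first edge, and there are finitely many edges.
    have hfin : P.Finite := by
      refine Set.Finite.of_finite_image (f := fun γ => (γ.dart 0).1) (Set.toFinite _) ?_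
      intro γ hγ γ' hγ' H
      exact congrArg Sigma.fst (hP.position_unique hγ hγ' H)
    have hsum : ∀ e, ∑ γ ∈ hfin.toFinset, x (γ.dart 0).1 * (if γ.Uses e then 1 else 0) = x e := by
      intro e
      obtain ⟨γ, hγ, i, hi⟩ := hP.exists_position e
      rw [Finset.sum_eq_single γ]
      · rw [if_pos ⟨i, hi⟩, mul_one, ← hconst γ hγ i, hi]
      · intro γ' hγ' hne
        rw [if_neg, mul_zero]
        exact fun hu => hne ((hP e).unique ⟨hfin.mem_toFinset.1 hγ', hu⟩ ⟨hγ, i, hi⟩)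
      · exact fun H => absurd (hfin.mem_toFinset.2 hγ) H
    -- By `hsum`, `x` is the combination of circuit indicators with coefficients `x (γ.dart 0).1`;
    -- the same coefficients express `n` in core vectors.
    have hn : n = ∑ γ ∈ hfin.toFinset, x (γ.dart 0).1 • γ.coreVector := by
      ext v
      obtain ⟨h, h', rfl, hv, h1, h2⟩ := hF.exists_other τ v
      rw [(hx _).2 h h' rfl hv h1 h2, ← hsum h.1, ← hsum h'.1, ← Finset.sum_add_distrib,
        Finset.sum_apply]
      refine Finset.sum_congr rfl fun γ hγ => ?_
      rw [Pi.smul_apply, hτ.coreVector_apply hF (hfin.mem_toFinset.1 hγ) hv h1 h2, smul_eq_mul,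
        mul_add]
    rw [hn]
    exact Submodule.sum_mem _ fun γ hγ =>
      Submodule.smul_mem _ _ (Submodule.subset_span ⟨γ, hfin.mem_toFinset.1 hγ, rfl⟩)

/-! ### Local conditions at a vertex, by type of transition. -/

theorem involvesPhi_iff {C P : Set F.Circuit} (hC : IsCircuitPartition C)
    (hP : IsCircuitPartition P) {σ τ : E × Bool → E × Bool} (hσ : IsPartner C σ)
    (hτ : IsPartner P τ) (v : V) :
    InvolvesPhi C P v ↔ ∀ h, F.vtx h = v → τ h = σ h := by
  unfold InvolvesPhi
  constructor
  · intro H h hv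
    have := (hτ.mem_transitionAt hP v h (τ h)).2 ⟨hv, rfl⟩
    rw [H, hσ.mem_transitionAt hC] at this
    exact this.2
  · intro H
    ext p
    induction p using Sym2.ind with
    | _ h h' =>
      rw [hσ.mem_transitionAt hC, hτ.mem_transitionAt hP]
      exact and_congr_right fun hv => by rw [H h hv]

/-- The three possibilities for the transition of `P` at a vertex, in terms of the passages of the
Euler system. -/
theorem transition_cases {C P : Set F.Circuit} (hC : IsCircuitPartition C)
    (hP : IsCircuitPartition P) {τ : E × Bool → E × Bool} (hτ : IsPartner P τ) {v : V}
    {γ : F.Circuit} (hγ : γ ∈ C) {i j : Fin (γ.len + 1)} (hij : i ≠ j)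
    (hv : ∀ h, F.vtx h = v ↔ h = flip (γ.dart i) ∨ h = γ.dart (i + 1) ∨
        h = flip (γ.dart j) ∨ h = γ.dart (j + 1)) :
    (InvolvesPhi C P v ∧ τ (flip (γ.dart i)) = γ.dart (i + 1) ∧
      τ (flip (γ.dart j)) = γ.dart (j + 1)) ∨
    (¬ InvolvesPhi C P v ∧ ¬ InvolvesPsi C P v ∧ τ (flip (γ.dart i)) = γ.dart (j + 1) ∧
      τ (flip (γ.dart j)) = γ.dart (i + 1)) ∨
    (¬ InvolvesPhi C P v ∧ InvolvesPsi C P v ∧ τ (flip (γ.dart i)) = flip (γ.dart j) ∧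
      τ (γ.dart (i + 1)) = γ.dart (j + 1)) := by
  obtain ⟨σ, hσ⟩ := hC.exists_partner
  have hphi := involvesPhi_iff hC hP hσ hτ v
  have hpsi : InvolvesPsi C P v ↔ ¬ InvolvesPhi C P v ∧ ¬ IsConsistent C (transitionAt P v) :=
    Iff.rfl
  have hcons : IsConsistent C (transitionAt P v) ↔
      ∀ h, F.vtx h = v → (IsOutgoing C h ↔ ¬ IsOutgoing C (τ h)) := by
    unfold IsConsistent
    simp only [hτ.mem_transitionAt hP]
    exact ⟨fun H h hv => H h _ ⟨hv, rfl⟩, fun H h h' ⟨hv, e⟩ => e ▸ H h hv⟩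
  have o1 := isOutgoing_dart hγ (i + 1)
  have o2 := isOutgoing_dart hγ (j + 1)
  have n1 := hC.not_isOutgoing_flip_dart hγ i
  have n2 := hC.not_isOutgoing_flip_dart hγ j
  have s1 := hσ.flip_dart γ hγ i
  have s2 := hσ.flip_dart γ hγ j
  have hne1 : flip (γ.dart i) ≠ flip (γ.dart j) := fun H =>
    hij (γ.edge_injective (by simpa using congrArg Prod.fst H))
  have hne2 : γ.dart (i + 1) ≠ γ.dart (j + 1) := fun H =>
    hij (add_right_cancel (γ.edge_injective (congrArg Prod.fst H)))
  rw [hpsi, hphi, hcons]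
  -- The passages are `a → b` and `c → d`: `a`, `c` are incoming and `b`, `d` outgoing.
  generalize flip (γ.dart i) = a at *
  generalize flip (γ.dart j) = c at *
  generalize γ.dart (i + 1) = b at *
  generalize γ.dart (j + 1) = d at *
  have t1 := hτ.invol
  have t2 := hτ.ne
  have t3 := hτ.vtx
  have t4 := hσ.invol
  have sb : σ b = a := by rw [← s1, t4]
  have sd : σ d = c := by rw [← s2, t4]
  have va : F.vtx a = v := (hv a).2 (by simp)
  have vb : F.vtx b = v := (hv b).2 (by simp)
  have vc : F.vtx c = v := (hv c).2 (by simp)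
  have vd : F.vtx d = v := (hv d).2 (by simp)
  have hab : a ≠ b := fun H => n1 (H ▸ o1)
  have had : a ≠ d := fun H => n1 (H ▸ o2)
  have hcb : c ≠ b := fun H => n2 (H ▸ o1)
  have hcd : c ≠ d := fun H => n2 (H ▸ o2)
  have inj : ∀ {h k}, τ h = τ k → h = k := fun {h k} H => by rw [← t1 h, H, t1]
  -- The mate of `a` decides the transition: `b` gives `φ`, `c` gives `ψ`, `d` gives `χ`. The other
  -- pair is what remains.
  rcases (hv (τ a)).1 ((t3 a).trans va) with ta | ta | ta | ta
  · exact absurd ta (t2 a)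
  · have tb : τ b = a := by rw [← ta, t1]
    have tc : τ c = d := by
      rcases (hv (τ c)).1 ((t3 c).trans vc) with tc | tc | tc | tc
      · exact absurd (inj (tc.trans tb.symm)) hcb
      · exact absurd (inj (tc.trans ta.symm)) hne1.symm
      · exact absurd tc (t2 c)
      · exact tc
    have td : τ d = c := by rw [← tc, t1]
    refine .inl ⟨fun h hh => ?_, ta, tc⟩
    rcases (hv h).1 hh with rfl | rfl | rfl | rfl
    · rw [ta, s1]
    · rw [tb, sb]
    · rw [tc, s2]
    · rw [td, sd]
  · have tc : τ c = a := by rw [← ta, t1]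
    have tb : τ b = d := by
      rcases (hv (τ b)).1 ((t3 b).trans vb) with tb | tb | tb | tb
      · exact absurd (inj (tb.trans tc.symm)) hcb.symm
      · exact absurd tb (t2 b)
      · exact absurd (inj (tb.trans ta.symm)) hab.symm
      · exact tb
    have hφ : ¬ ∀ h, F.vtx h = v → τ h = σ h := fun H =>
      hcb (by rw [← ta, H a va, s1])
    refine .inr (.inr ⟨hφ, ⟨hφ, fun H => ?_⟩, ta, tb⟩)
    have := H a va
    rw [ta] at this
    exact n1 (this.2 n2)
  · have td : τ d = a := by rw [← ta, t1]
    have tc : τ c = b := by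
      rcases (hv (τ c)).1 ((t3 c).trans vc) with tc | tc | tc | tc
      · exact absurd (inj (tc.trans td.symm)) hcd
      · exact tc
      · exact absurd tc (t2 c)
      · exact absurd (inj (tc.trans ta.symm)) hne1.symm
    have tb : τ b = c := by rw [← tc, t1]
    have hφ : ¬ ∀ h, F.vtx h = v → τ h = σ h := fun H =>
      hne2 (by rw [← ta, H a va, s1])
    refine .inr (.inl ⟨hφ, fun H => H.2 fun h hh => ?_, ta, tc⟩)
    rcases (hv h).1 hh with rfl | rfl | rfl | rfl
    · rw [ta]; simp [n1, o2]
    · rw [tb]; simp [n2, o1]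
    · rw [tc]; simp [n2, o1]
    · rw [td]; simp [n1, o2]

open scoped Classical in
/-- The conditions of the core space at a vertex, in terms of the Euler system. -/
theorem core_condition_iff {C P : Set F.Circuit}
    (hC : IsCircuitPartition C)
    (hP : IsCircuitPartition P) {τ : E × Bool → E × Bool} (hτ : IsPartner P τ) {v : V}
    {γ : F.Circuit} (hγ : γ ∈ C) {i j : Fin (γ.len + 1)} (hij : i ≠ j)
    (hv : ∀ h, F.vtx h = v ↔ h = flip (γ.dart i) ∨ h = γ.dart (i + 1) ∨
        h = flip (γ.dart j) ∨ h = γ.dart (j + 1)) (x : E → ZMod 2) (n : V → ZMod 2) :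
    ((∀ h, F.vtx h = v → x (τ h).1 = x h.1) ∧
      ∀ h h', F.vtx h = v → F.vtx h' = v → h' ≠ h → h' ≠ τ h → n v = x h.1 + x h'.1) ↔
    x (γ.dart (i + 1)).1 = x (γ.dart i).1 + (if InvolvesPhi C P v then 0 else n v) ∧
    x (γ.dart (j + 1)).1 = x (γ.dart j).1 + (if InvolvesPhi C P v then 0 else n v) ∧
    x (γ.dart (i + 1)).1 + x (γ.dart (j + 1)).1 =
      if InvolvesPhi C P v then n v else if InvolvesPsi C P v then 0 else n v := by
  have o1 := isOutgoing_dart hγ (i + 1)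
  have o2 := isOutgoing_dart hγ (j + 1)
  have n1 := hC.not_isOutgoing_flip_dart hγ i
  have n2 := hC.not_isOutgoing_flip_dart hγ j
  have hne1 : flip (γ.dart i) ≠ flip (γ.dart j) := fun H =>
    hij (γ.edge_injective (by simpa using congrArg Prod.fst H))
  have hne2 : γ.dart (i + 1) ≠ γ.dart (j + 1) := fun H =>
    hij (add_right_cancel (γ.edge_injective (congrArg Prod.fst H)))
  have hcases := transition_cases hC hP hτ hγ hij hv
  rw [← flip_fst (γ.dart i), ← flip_fst (γ.dart j)]
  generalize flip (γ.dart i) = a at *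
  generalize flip (γ.dart j) = c at *
  generalize γ.dart (i + 1) = b at *
  generalize γ.dart (j + 1) = d at *
  have t1 := hτ.invol
  have hab : a ≠ b := fun H => n1 (H ▸ o1)
  have had : a ≠ d := fun H => n1 (H ▸ o2)
  have hcb : c ≠ b := fun H => n2 (H ▸ o1)
  have hcd : c ≠ d := fun H => n2 (H ▸ o2)
  have va : F.vtx a = v := (hv a).2 (by simp)
  have vb : F.vtx b = v := (hv b).2 (by simp)
  have vc : F.vtx c = v := (hv c).2 (by simp)
  have vd : F.vtx d = v := (hv d).2 (by simp)
  have two : ∀ z : ZMod 2, z + z = 0 := by decide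
  rcases hcases with ⟨h1, ta, tc⟩ | ⟨h1, h2, ta, tc⟩ | ⟨h1, h2, ta, tb⟩
  · have tb : τ b = a := by rw [← ta, t1]
    have td : τ d = c := by rw [← tc, t1]
    simp only [h1, if_true, add_zero]
    constructor
    · rintro ⟨H1, H2⟩
      have e1 := H1 a va
      have e2 := H1 c vc
      rw [ta] at e1
      rw [tc] at e2
      exact ⟨e1, e2, (H2 b d vb vd hne2.symm (by rw [tb]; exact had.symm)).symm⟩
    · rintro ⟨e1, e2, e3⟩
      refine ⟨fun h hh => ?_, fun h h' hh hh' p q => ?_⟩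
      · rcases (hv h).1 hh with rfl | rfl | rfl | rfl <;> simp [*]
      · rcases (hv h).1 hh with rfl | rfl | rfl | rfl <;>
          rcases (hv h').1 hh' with rfl | rfl | rfl | rfl <;> grind
  · have td : τ d = a := by rw [← ta, t1]
    have tb : τ b = c := by rw [← tc, t1]
    simp only [h1, h2, if_false]
    constructor
    · rintro ⟨H1, H2⟩
      have e1 := H1 a va
      have e2 := H1 c vc
      rw [ta] at e1
      rw [tc] at e2
      have e3 := H2 b d vb vd hne2.symm (by rw [tb]; exact hcd.symm)
      refine ⟨?_, ?_, e3.symm⟩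
      · rw [e3, e1, add_comm (x b.1), ← add_assoc, two, zero_add]
      · rw [e3, ← e2, ← add_assoc, two, zero_add]
    · rintro ⟨e1, e2, e3⟩
      have e4 : x d.1 = x a.1 := by
        generalize x a.1 = p, x c.1 = q, x d.1 = r, n v = s, x b.1 = t at *
        revert p q r s t; decide
      have e5 : x c.1 = x b.1 := by
        generalize x a.1 = p, x c.1 = q, x d.1 = r, n v = s, x b.1 = t at *
        revert p q r s t; decide
      refine ⟨fun h hh => ?_, fun h h' hh hh' p q => ?_⟩
      · rcases (hv h).1 hh with rfl | rfl | rfl | rfl <;> grind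
      · rcases (hv h).1 hh with rfl | rfl | rfl | rfl <;>
          rcases (hv h').1 hh' with rfl | rfl | rfl | rfl <;> grind
  · have tc : τ c = a := by rw [← ta, t1]
    have td : τ d = b := by rw [← tb, t1]
    simp only [h1, h2, if_false, if_true]
    constructor
    · rintro ⟨H1, H2⟩
      have e1 := H1 a va
      have e2 := H1 b vb
      rw [ta] at e1
      rw [tb] at e2
      have e3 := H2 b a vb va hab (by rw [tb]; exact had)
      refine ⟨?_, ?_, ?_⟩
      · rw [e3, add_comm (x b.1), ← add_assoc, two, zero_add]
      · rw [e3, e1, e2, add_comm (x b.1), ← add_assoc, two, zero_add]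
      · rw [e2, two]
    · rintro ⟨e1, e2, e3⟩
      have e4 : x d.1 = x b.1 := by
        clear e1 e2
        generalize x d.1 = p, x b.1 = q at *
        revert p q; decide
      have e5 : x c.1 = x a.1 := by
        rw [e4, e1] at e2
        exact (add_right_cancel e2).symm
      have e6 : n v = x a.1 + x b.1 := by
        rw [e1, ← add_assoc, two, zero_add]
      refine ⟨fun h hh => ?_, fun h h' hh hh' p q => ?_⟩
      · rcases (hv h).1 hh with rfl | rfl | rfl | rfl <;> grind
      · rcases (hv h).1 hh with rfl | rfl | rfl | rfl <;>
          rcases (hv h').1 hh' with rfl | rfl | rfl | rfl <;> grind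

/-! ### Prefix sums along Euler circuits and interlacement. -/

/-- The positions at which a circuit of the Euler system passes a vertex. -/
theorem IsEulerSystem.vtx_dart_iff {C : Set F.Circuit} (hC : IsEulerSystem C) {γ : F.Circuit}
    (hγ : γ ∈ C) {v : V} {i j : Fin (γ.len + 1)}
    (hv : ∀ h, F.vtx h = v ↔ h = flip (γ.dart i) ∨ h = γ.dart (i + 1) ∨
        h = flip (γ.dart j) ∨ h = γ.dart (j + 1)) (k : Fin (γ.len + 1)) :
    F.vtx (γ.dart k) = v ↔ k = i + 1 ∨ k = j + 1 := by
  rw [hv]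
  have e : ∀ l, γ.dart k = γ.dart l ↔ k = l := fun l =>
    ⟨fun H => γ.edge_injective (congrArg Prod.fst H), fun H => H ▸ rfl⟩
  have e' : ∀ l, γ.dart k ≠ flip (γ.dart l) := fun l H =>
    hC.isCircuitPartition.not_isOutgoing_flip_dart hγ l
      (H ▸ isOutgoing_dart hγ k)
  simp [e, e']

open scoped Classical in
/-- Two positions of `v` on a circuit separate the positions of `w` exactly when `v` and `w` are
interlaced. -/
theorem IsEulerSystem.sum_prefix_eq [Finite E] (hF : F.IsFourRegular)
    {C : Set F.Circuit} (hC : IsEulerSystem C) {γ : F.Circuit} (hγ : γ ∈ C) {v : V}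
    {i j : Fin (γ.len + 1)} (hij : i ≠ j)
    (hv : ∀ k, F.vtx (γ.dart k) = v ↔ k = i ∨ k = j) (w : V) :
    ∑ k, (if F.vtx (γ.dart k) = w then
        ((if k ≤ i then 1 else 0) + (if k ≤ j then 1 else 0) : ZMod 2) else 0) =
      (if w = v then 1 else 0) + (interlacementGraph C).adjMatrix (ZMod 2) v w := by
  have hvis : ∀ {γ' : F.Circuit}, γ' ∈ C → ∀ k, F.vtx (γ'.dart k) = v → γ' = γ :=
    fun hγ' k hk => hC.circuit_unique hγ' hγ (hk.trans ((hv i).2 (.inl rfl)).symm)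
  have hadj : (interlacementGraph C).Adj v w ↔ v ≠ w ∧ (γ.Alternates v w ∨ γ.Alternates w v) := by
    refine and_congr_right fun _ => ⟨?_, fun H => ⟨γ, hγ, H⟩⟩
    rintro ⟨γ', hγ', H⟩
    have : γ' = γ := by
      rcases H with ⟨a, _, _, _, _, _, _, ha, _⟩ | ⟨_, b, _, _, _, _, _, _, hb, _⟩
      · exact hvis hγ' a ha
      · exact hvis hγ' b hb
    exact this ▸ H
  rw [SimpleGraph.adjMatrix_apply, hadj, ← Finset.sum_filter]
  obtain ⟨δ, hδ, p, q, hpq, hw⟩ := hC.exists_passages hF w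
  by_cases hδγ : δ = γ
  · subst hδγ
    have hw' := hC.vtx_dart_iff hδ hw
    have hpq' : p + 1 ≠ q + 1 := fun H => hpq (add_right_cancel H)
    generalize p + 1 = p at *
    generalize q + 1 = q at *
    have hfil : Finset.univ.filter (fun k => F.vtx (δ.dart k) = w) = {p, q} := by
      ext k; simp [hw']
    rw [hfil, Finset.sum_pair hpq']
    unfold Circuit.Alternates
    simp only [hv, hw']
    by_cases hvw : v = w
    · have hi := (hw' i).1 (by rw [← hvw, hv]; simp)
      have hj := (hw' j).1 (by rw [← hvw, hv]; simp)
      simp only [hvw, if_true, ne_eq, not_true_eq_false, false_and, if_false, add_zero]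
      have : (i = p ∧ j = q) ∨ (i = q ∧ j = p) := by grind
      -- For `w = v`, the earlier position lies in both prefixes and contributes `1 + 1 = 0`; the
      -- later lies in one and contributes `1`.
      rcases this with ⟨rfl, rfl⟩ | ⟨rfl, rfl⟩ <;>
        rcases lt_or_gt_of_ne hij with H | H <;>
        simp [H.le, H.not_ge] <;> decide
    · have hip : i ≠ p := fun H => hvw (by rw [← (hv i).2 (.inl rfl), (hw' i).2 (.inl H)])
      have hiq : i ≠ q := fun H => hvw (by rw [← (hv i).2 (.inl rfl), (hw' i).2 (.inr H)])
      have hjp : j ≠ p := fun H => hvw (by rw [← (hv j).2 (.inr rfl), (hw' j).2 (.inl H)])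
      have hjq : j ≠ q := fun H => hvw (by rw [← (hv j).2 (.inr rfl), (hw' j).2 (.inr H)])
      simp only [Ne.symm hvw, if_false, zero_add, hvw, ne_eq, not_false_eq_true, true_and]
      -- A position is counted an odd number of times exactly when it falls between `i` and `j`.
      -- Alternation means that this happens for exactly one of `p`, `q`, wherever the circuit is
      -- cut open.
      have halt : ((∃ a b c d, a < b ∧ b < c ∧ c < d ∧ (a = i ∨ a = j) ∧ (b = p ∨ b = q) ∧
          (c = i ∨ c = j) ∧ (d = p ∨ d = q)) ∨
          (∃ a b c d, a < b ∧ b < c ∧ c < d ∧ (a = p ∨ a = q) ∧ (b = i ∨ b = j) ∧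
          (c = p ∨ c = q) ∧ (d = i ∨ d = j))) ↔ ¬ ((p ≤ i ↔ p ≤ j) ↔ (q ≤ i ↔ q ≤ j)) := by
        constructor
        · rintro (⟨a, b, c, d, h1, h2, h3, rfl | rfl, rfl | rfl, rfl | rfl, rfl | rfl⟩ |
            ⟨a, b, c, d, h1, h2, h3, rfl | rfl, rfl | rfl, rfl | rfl, rfl | rfl⟩) <;> grind
        · intro H
          rcases lt_or_gt_of_ne hij with h1 | h1 <;> rcases lt_or_gt_of_ne hip with h2 | h2 <;>
          rcases lt_or_gt_of_ne hiq with h3 | h3 <;> rcases lt_or_gt_of_ne hjp with h4 | h4 <;>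
          rcases lt_or_gt_of_ne hjq with h5 | h5 <;>
          first
          | exact absurd H (by grind)
          | exact .inl ⟨i, p, j, q, by grind⟩
          | exact .inl ⟨i, q, j, p, by grind⟩
          | exact .inl ⟨j, p, i, q, by grind⟩
          | exact .inl ⟨j, q, i, p, by grind⟩
          | exact .inr ⟨p, i, q, j, by grind⟩
          | exact .inr ⟨p, j, q, i, by grind⟩
          | exact .inr ⟨q, i, p, j, by grind⟩
          | exact .inr ⟨q, j, p, i, by grind⟩
      simp only [halt]
      by_cases h1 : p ≤ i <;> by_cases h2 : p ≤ j <;> by_cases h3 : q ≤ i <;>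
        by_cases h4 : q ≤ j <;> simp [h1, h2, h3, h4] <;> decide
  · have hno : ∀ k, F.vtx (γ.dart k) ≠ w := fun k hk =>
      hδγ (hC.circuit_unique hδ hγ (i := p + 1) (((hw _).2 (by simp)).trans hk.symm))
    have hvw : v ≠ w := fun H => hno i (H ▸ (hv i).2 (.inl rfl))
    have halt : ¬ (γ.Alternates v w ∨ γ.Alternates w v) := by
      rintro (⟨_, b, _, _, _, _, _, _, hb, _⟩ | ⟨a, _, _, _, _, _, _, ha, _⟩)
      · exact hno b hb
      · exact hno a ha
    simp [hno, hvw.symm, halt]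

-- Grouping positions by vertex, the coefficient of `d w` is the count in `sum_prefix_eq`.
open scoped Classical in
theorem IsEulerSystem.sum_Iic_add_sum_Iic [Finite E] [Fintype V] (hF : F.IsFourRegular)
    {C : Set F.Circuit} (hC : IsEulerSystem C) {γ : F.Circuit} (hγ : γ ∈ C) {v : V}
    {i j : Fin (γ.len + 1)} (hij : i ≠ j)
    (hv : ∀ k, F.vtx (γ.dart k) = v ↔ k = i ∨ k = j) (d : V → ZMod 2) :
    ∑ k ∈ Finset.Iic i, d (F.vtx (γ.dart k)) + ∑ k ∈ Finset.Iic j, d (F.vtx (γ.dart k)) =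
      d v + ∑ w, (interlacementGraph C).adjMatrix (ZMod 2) v w * d w := by
  have h1 : ∀ i, ∑ k ∈ Finset.Iic i, d (F.vtx (γ.dart k)) =
      ∑ k, if k ≤ i then d (F.vtx (γ.dart k)) else 0 := by
    intro i
    rw [← Finset.sum_filter]
    congr 1
    ext k; simp
  have h2 : d v = ∑ w, (if w = v then 1 else 0) * d w := by simp
  rw [h1, h1, h2, ← Finset.sum_add_distrib, ← Finset.sum_add_distrib]
  simp_rw [← add_mul, ← hC.sum_prefix_eq hF hγ hij hv, Finset.sum_mul]
  rw [Finset.sum_comm]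
  refine Finset.sum_congr rfl fun k _ => ?_
  rw [Finset.sum_eq_single (F.vtx (γ.dart k))]
  · simp only [if_true]
    split_ifs <;> ring
  · intro w _ hw
    rw [if_neg hw.symm, zero_mul]
  · simp

-- A circuit of `C` passes each vertex twice or not at all. This makes prefix sums consistent around
-- the circuit.
open scoped Classical in
theorem IsEulerSystem.sum_univ_eq_zero [Finite E] [Fintype V] (hF : F.IsFourRegular)
    {C : Set F.Circuit} (hC : IsEulerSystem C) {γ : F.Circuit} (hγ : γ ∈ C) (d : V → ZMod 2) :
    ∑ k, d (F.vtx (γ.dart k)) = 0 := by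
  rw [← Finset.sum_fiberwise' (s := Finset.univ) (fun k => F.vtx (γ.dart k)) d]
  refine Finset.sum_eq_zero fun w _ => ?_
  obtain ⟨δ, hδ, p, q, hpq, hw⟩ := hC.exists_passages hF w
  by_cases hδγ : δ = γ
  · subst hδγ
    have hfil : Finset.univ.filter (fun k => F.vtx (δ.dart k) = w) = {p + 1, q + 1} := by
      ext k; simp [hC.vtx_dart_iff hγ hw]
    rw [hfil, Finset.sum_pair fun H => hpq (add_right_cancel H)]
    exact CharTwo.add_self_eq_zero _
  · have hno : ∀ k, F.vtx (γ.dart k) ≠ w := fun k hk =>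
      hδγ (hC.circuit_unique hδ hγ (i := p + 1) (((hw _).2 (by simp)).trans hk.symm))
    simp [hno]

/-- The addition is cyclic: at the last position `k + 1 = 0` and the prefix shrinks to `{0}`, which
is where the vanishing total enters. -/
theorem sum_Iic_add_one {m : ℕ} (f : Fin (m + 1) → ZMod 2) (hf : ∑ k, f k = 0)
    (k : Fin (m + 1)) :
    ∑ l ∈ Finset.Iic (k + 1), f l = ∑ l ∈ Finset.Iic k, f l + f (k + 1) := by
  induction k using Fin.lastCases with
  | last =>
    have h0 : Finset.Iic (0 : Fin (m + 1)) = {0} := by ext l; simp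
    have h1 : Finset.Iic (Fin.last m) = Finset.univ := by ext l; simp [Fin.le_last]
    rw [Fin.last_add_one, h0, h1, hf, Finset.sum_singleton, zero_add]
  | cast k =>
    rw [Fin.coeSucc_eq_succ]
    have : Finset.Iic k.succ = insert k.succ (Finset.Iic k.castSucc) := by
      ext l
      simp only [Finset.mem_Iic, Finset.mem_insert, Fin.le_def, Fin.ext_iff, Fin.val_succ,
        Fin.val_castSucc]
      omega
    rw [this, Finset.sum_insert (by simp [Fin.le_def]), add_comm]

/-- Prescribed jumps determine `y` up to a constant. The term `f 0` corrects for the prefix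
including position `0`. -/
theorem eq_add_sum_Iic {m : ℕ} (f y : Fin (m + 1) → ZMod 2)
    (hy : ∀ k, y (k + 1) = y k + f (k + 1)) (hf : ∑ k, f k = 0) (k : Fin (m + 1)) :
    y k = y 0 + f 0 + ∑ l ∈ Finset.Iic k, f l := by
  induction k using Fin.induction with
  | zero =>
    have h0 : Finset.Iic (0 : Fin (m + 1)) = {0} := by ext l; simp
    rw [h0, Finset.sum_singleton, add_assoc, CharTwo.add_self_eq_zero, add_zero]
  | succ k ih =>
    rw [← Fin.coeSucc_eq_succ, hy, sum_Iic_add_one f hf, ih, add_assoc]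

/-! ### The kernel of the modified matrix, and the conclusion. -/

open scoped Classical in
-- A `φ` column is a unit vector, so its coordinate of `n` acts only in its own row. The column
-- changes thus become zeroing those coordinates in the adjacency product and adding a diagonal term
-- for `φ` and `ψ`.
theorem mem_ker_modifiedInterlacementMatrix_iff [Fintype V] (C P : Set F.Circuit)
    (n : V → ZMod 2) :
    n ∈ LinearMap.ker (modifiedInterlacementMatrix C P).mulVecLin ↔ ∀ v,
      ∑ w, (interlacementGraph C).adjMatrix (ZMod 2) v w *
        (if InvolvesPhi C P w then 0 else n w) +
        (if InvolvesPhi C P v ∨ InvolvesPsi C P v then n v else 0) = 0 := by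
  rw [LinearMap.mem_ker, Matrix.mulVecLin_apply, funext_iff]
  refine forall_congr' fun v => ?_
  have h2 : (if InvolvesPhi C P v ∨ InvolvesPsi C P v then n v else 0) =
      ∑ w, if v = w then (if InvolvesPhi C P w ∨ InvolvesPsi C P w then n w else 0) else 0 := by
    simp
  rw [h2, ← Finset.sum_add_distrib]
  refine Eq.congr (Finset.sum_congr rfl fun w _ => ?_) rfl
  by_cases hvw : v = w
  · subst hvw
    by_cases h1 : InvolvesPhi C P v <;> by_cases h2 : InvolvesPsi C P v <;>
      simp [modifiedInterlacementMatrix, h1, h2]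
  · by_cases h1 : InvolvesPhi C P w <;> simp [modifiedInterlacementMatrix, h1, hvw]

end HalfEdgeGraph

theorem mainTheorem4 {V E : Type*} [Fintype V] [Fintype E] (F : HalfEdgeGraph V E)
    (hF : F.IsFourRegular) (P : Set F.Circuit) (hP : HalfEdgeGraph.IsCircuitPartition P)
    (C : Set F.Circuit) (hC : HalfEdgeGraph.IsEulerSystem C) :
    HalfEdgeGraph.coreSpace P =
      LinearMap.ker (HalfEdgeGraph.modifiedInterlacementMatrix C P).mulVecLin := by
  classical
  have hC' := hC.isCircuitPartition
  obtain ⟨τ, hτ⟩ := hP.exists_partner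
  ext n
  rw [hτ.mem_coreSpace_iff hF hP, HalfEdgeGraph.mem_ker_modifiedInterlacementMatrix_iff]
  -- The jump of the weighting at each passage of `v`.
  set d : V → ZMod 2 := fun v => if HalfEdgeGraph.InvolvesPhi C P v then 0 else n v with hd
  have row : ∀ (v : V) (S : ZMod 2),
      (d v + S = if HalfEdgeGraph.InvolvesPhi C P v then n v else
        if HalfEdgeGraph.InvolvesPsi C P v then 0 else n v) ↔
      S + (if HalfEdgeGraph.InvolvesPhi C P v ∨ HalfEdgeGraph.InvolvesPsi C P v then n v else 0)
        = 0 := by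
    intro v S
    have h2 : ∀ a b : ZMod 2, (0 + a = b ↔ a + b = 0) ∧ (b + a = 0 ↔ a + b = 0) ∧
      (b + a = b ↔ a + 0 = 0) := by decide
    by_cases h : HalfEdgeGraph.InvolvesPhi C P v <;>
      by_cases h' : HalfEdgeGraph.InvolvesPsi C P v <;>
      simp only [hd, h, h', if_true, if_false, or_true, or_false] <;>
      first | exact (h2 _ _).1 | exact (h2 _ _).2.1 | exact (h2 _ _).2.2
  constructor
  · rintro ⟨x, hx⟩ v
    have step : ∀ γ ∈ C, ∀ k, x (γ.dart (k + 1)).1 = x (γ.dart k).1 +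
        d (F.vtx (γ.dart (k + 1))) := by
      intro γ hγ k
      obtain ⟨δ, hδ, i, j, hij, hv⟩ := hC.exists_passages hF (F.vtx (γ.dart (k + 1)))
      have hH := (HalfEdgeGraph.core_condition_iff hC' hP hτ hδ hij hv x n).1 (hx _)
      obtain rfl : γ = δ := hC.circuit_unique hγ hδ (j := i + 1) ((hv _).2 (by simp)).symm
      rcases (hC.vtx_dart_iff hγ hv (k + 1)).1 rfl with H | H <;>
        obtain rfl := add_right_cancel H
      · exact hH.1
      · exact hH.2.1
    obtain ⟨γ, hγ, i, j, hij, hv⟩ := hC.exists_passages hF v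
    have hH := (HalfEdgeGraph.core_condition_iff hC' hP hτ hγ hij hv x n).1 (hx _)
    have hsum := hC.sum_Iic_add_sum_Iic hF hγ (fun H => hij (add_right_cancel H))
      (hC.vtx_dart_iff hγ hv) d
    have hy := HalfEdgeGraph.eq_add_sum_Iic (fun k => d (F.vtx (γ.dart k)))
      (fun k => x (γ.dart k).1) (step γ hγ) (hC.sum_univ_eq_zero hF hγ d)
    -- The unknown constant of the weighting on `γ` occurs in both terms and cancels.
    rw [← row, ← hsum, ← hH.2.2, hy (i + 1), hy (j + 1), add_add_add_comm,
      CharTwo.add_self_eq_zero, zero_add]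
  · intro hn
    -- Conversely, integrate the jumps from the start of each Euler circuit; this is well defined
    -- since each edge has one position in `C`.
    obtain ⟨x, hx⟩ : ∃ x : E → ZMod 2, ∀ δ ∈ C, ∀ l : Fin (δ.len + 1),
        x (δ.dart l).1 = ∑ m ∈ Finset.Iic l, d (F.vtx (δ.dart m)) := by
      choose γ hγ k hk using hC'.exists_position
      refine ⟨fun e => ∑ m ∈ Finset.Iic (k e), d (F.vtx ((γ e).dart m)), fun δ hδ l => ?_⟩
      exact congrArg (fun s : Σ γ : F.Circuit, Fin (γ.len + 1) =>
        ∑ m ∈ Finset.Iic s.2, d (F.vtx (s.1.dart m)))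
        (hC'.position_unique (hγ _) hδ (hk (δ.dart l).1))
    refine ⟨x, fun v => ?_⟩
    obtain ⟨δ, hδ, i, j, hij, hv⟩ := hC.exists_passages hF v
    rw [HalfEdgeGraph.core_condition_iff hC' hP hτ hδ hij hv]
    have hdart := hC.vtx_dart_iff hδ hv
    have hz := hC.sum_univ_eq_zero hF hδ d
    simp only [hx δ hδ]
    refine ⟨?_, ?_, ?_⟩
    · rw [HalfEdgeGraph.sum_Iic_add_one _ hz, (hdart (i + 1)).2 (.inl rfl)]
    · rw [HalfEdgeGraph.sum_Iic_add_one _ hz, (hdart (j + 1)).2 (.inr rfl)]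
    · rw [hC.sum_Iic_add_sum_Iic hF hδ (fun H => hij (add_right_cancel H)) hdart d]
      exact (row v _).2 (hn v)
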